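/- Let $d,k\ge 1$ be integers, $\tilde k=\min\{k,d\}$ and $\lambda>0$. Let $\mathcal S_+^d$ be the cone of real symmetric positive semidefinite $d\times d$ matrices. For $\boldsymbol X\in\mathcal S_+^d$ with eigenvalues $\sigma_1\ge\cdots\ge\sigma_d\ge 0$ put $\Gamma(\boldsymbol X;\lambda)=\sum_{i=1}^{\tilde k}\frac{1}{\sigma_i+\lambda}$, and let $\operatorname{conv}\Gamma$ be the convex envelope of $\Gamma$ on $\mathcal S_+^d$, that is, the pointwise supremum of all convex functions on $\mathcal S_+^d$ that lie below $\Gamma$. Then $\operatorname{conv}\Gamma$ is the greatest convex function on $\mathcal S_+^d$ below $\Gamma$, and for every $\boldsymbol X\in\mathcal S_+^d$ with eigenvalues $\sigma_1\ge\cdots\ge\sigma_d\ge0$ the following hold. There is a unique integer $\eta$, $0\le\eta\le\tilde k-1$, such that (with $\sigma_0=\infty$) $$\sigma_\eta>\frac{1}{\tilde k-\eta}\sum_{i=\eta+1}^d\sigma_i\ge\sigma_{\eta+1}.$$ With this $\eta$: (i) $$\operatorname{conv}\Gamma(\boldsymbol X;\lambda)=\sum_{i=1}^{\eta}\frac{1}{\sigma_i+\lambda}+\frac{(\tilde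 k-\eta)^2}{\sum_{i=\eta+1}^d\sigma_i+(\tilde k-\eta)\lambda}.$$ (ii) For every eigen-decomposition $\boldsymbol X=\boldsymbol Q\operatorname{Diag}(\boldsymbol\sigma)\boldsymbol Q^\top$ with $\boldsymbol Q$ orthogonal, the symmetric matrix $\boldsymbol W=\boldsymbol Q\operatorname{Diag}(\boldsymbol\varsigma)\boldsymbol Q^\top$ is a subgradient of $\operatorname{conv}\Gamma(\cdot;\lambda)$ at $\boldsymbol X$, i.e. $\operatorname{conv}\Gamma(\boldsymbol Y;\lambda)\ge\operatorname{conv}\Gamma(\boldsymbol X;\lambda)+\operatorname{tr}(\boldsymbol W(\boldsymbol Y-\boldsymbol X))$ for all $\boldsymbol Y\in\mathcal S_+^d$, where $$\varsigma_i=-\frac{1}{(\sigma_i+\lambda)^2}\ \ (1\le i\le\eta),\qquad \varsigma_i=-\left(\frac{\tilde k-\eta}{\sum_{j=\eta+1}^d\sigma_j+(\tilde k-\eta)\lambda}\right)^{2}\ \ (\eta+1\le i\le d).$$ -/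

import Mathlib

open scoped Matrix

/-- The convex envelope of `f` on `S`, as the pointwise supremum of all convex functions on `S`
that lie below `f` on `S`. -/
noncomputable def convexEnvelopeOn {E : Type*} [AddCommGroup E] [Module ℝ E]
    (S : Set E) (f : E → ℝ) (x : E) : ℝ :=
  sSup {y : ℝ | ∃ h : E → ℝ, ConvexOn ℝ S h ∧ (∀ z ∈ S, h z ≤ f z) ∧ h x = y}

/-- `g` is the greatest convex function on `S` that lies below `f` on `S`. -/
structure IsConvexEnvelopeOn {E : Type*} [AddCommGroup E] [Module ℝ E]
    (S : Set E) (f g : E → ℝ) : Prop where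
  convexOn : ConvexOn ℝ S g
  le : ∀ x ∈ S, g x ≤ f x
  greatest : ∀ h : E → ℝ, ConvexOn ℝ S h → (∀ x ∈ S, h x ≤ f x) → ∀ x ∈ S, h x ≤ g x

/-- The cone of real symmetric positive semidefinite `d × d` matrices. -/
def psdCone (d : ℕ) : Set (Matrix (Fin d) (Fin d) ℝ) :=
  {X | X.PosSemidef}

/-- The eigenvalues, with multiplicity and in nonincreasing order, of a real symmetric matrix. -/
noncomputable def sortedEigenvalues {d : ℕ} {X : Matrix (Fin d) (Fin d) ℝ}
    (hX : X.IsHermitian) (i : Fin d) : ℝ :=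
  hX.eigenvalues₀ (Fin.cast (Fintype.card_fin d).symm i)

open Classical in
/-- The sum of `1 / (σ_i + lam)` over the `m` largest eigenvalues `σ_i` of `X`
(the value `0` is given to matrices that are not symmetric; these lie outside the domain). -/
noncomputable def Gam {d : ℕ} (m : ℕ) (lam : ℝ) (X : Matrix (Fin d) (Fin d) ℝ) : ℝ :=
  if hX : X.IsHermitian then
    ∑ i : Fin d with i.val < m, 1 / (sortedEigenvalues hX i + lam)
  else 0

/-- `W` is a subgradient at `X`, in the space of real symmetric matrices with the inner product
`⟨A, B⟩ = tr (Aᵀ B)`, of the function `f` with domain `psdCone d`. -/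
def IsSubgradient {d : ℕ} (f : Matrix (Fin d) (Fin d) ℝ → ℝ)
    (X W : Matrix (Fin d) (Fin d) ℝ) : Prop :=
  W.IsSymm ∧ ∀ Y ∈ psdCone d, f X + (Wᵀ * (Y - X)).trace ≤ f Y

/-- `X = Q Diag(σ) Qᵀ` with `Q` orthogonal and `σ` in nonincreasing order. -/
structure IsEigenDecomposition {d : ℕ} (X Q : Matrix (Fin d) (Fin d) ℝ) (σ : Fin d → ℝ) :
    Prop where
  orthogonal : Q ∈ Matrix.orthogonalGroup (Fin d) ℝ
  antitone : Antitone σ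
  eq : X = Q * Matrix.diagonal σ * Qᵀ

/-- The sum of `σ_i` over the (one-based) indices `i = η + 1, …, d`. -/
def tailSum {d : ℕ} (σ : Fin d → ℝ) (η : ℕ) : ℝ :=
  ∑ i : Fin d with η ≤ i.val, σ i

/-- With one-based indices and `σ_0 = ∞`:
`0 ≤ η ≤ m - 1` and `σ_η > (1 / (m - η)) ∑_{i = η + 1}^d σ_i ≥ σ_{η + 1}`. -/
structure IsBreakIndex {d : ℕ} (m : ℕ) (σ : Fin d → ℝ) (η : ℕ) : Prop where
  lt : η < m
  above : ∀ i : Fin d, i.val + 1 = η → 1 / ((m : ℝ) - η) * tailSum σ η < σ i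
  below : ∀ i : Fin d, i.val = η → σ i ≤ 1 / ((m : ℝ) - η) * tailSum σ η

/-- `∑_{i ≤ η} 1 / (σ_i + lam) + (m - η)² / (∑_{i > η} σ_i + (m - η) lam)`. -/
noncomputable def envelopeValue {d : ℕ} (m : ℕ) (lam : ℝ) (σ : Fin d → ℝ) (η : ℕ) : ℝ :=
  ∑ i : Fin d with i.val < η, 1 / (σ i + lam)
    + ((m : ℝ) - η) ^ 2 / (tailSum σ η + ((m : ℝ) - η) * lam)

/-- The eigenvalues of the subgradient: `- 1 / (σ_i + lam)²` for `i ≤ η`, and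
`- ((m - η) / (∑_{j > η} σ_j + (m - η) lam))²` for all `i > η`. -/
noncomputable def subgradValue {d : ℕ} (m : ℕ) (lam : ℝ) (σ : Fin d → ℝ) (η : ℕ)
    (i : Fin d) : ℝ :=
  if i.val < η then -(1 / (σ i + lam)) ^ 2
  else -(((m : ℝ) - η) / (tailSum σ η + ((m : ℝ) - η) * lam)) ^ 2

/-! ### Convex envelopes -/

section ConvexEnvelope

variable {E : Type*} [AddCommGroup E] [Module ℝ E] {S : Set E} {f : E → ℝ}

/-! The value is pinned between two bounds at `X = Q Diag(σ) Qᵀ`; convexity of the closed formula is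
never checked directly. Upper bound: keep the first `η` eigenvalues and replace the others by the
common level `T / (m - η)`, where `T` is their sum. The ratios of `σ` to these levelled values lie
in `[0, 1]`, are `1` on the head and sum to `m`, so they average indicators of `m`-element sets
(`mem_convexHull_indicator`). Hence `X` averages matrices at which `Gam` is at most the claimed
value, and so is every convex minorant at `X` (`le_envelopeValue_of_convexOn`). Lower bound: with `a
i = 1 / (level + lam)`, the tangent inequality `1 / x ≥ 2 a - a² x` at the largest eigenvalues of
`Y`, combined with the trace inequality `sum_mul_sortedEigenvalues_le_trace`, gives an affine
minorant of `Gam` with slope `-Q Diag(a²) Qᵀ` (`envelopeValue_add_trace_le`). It competes in the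
supremum and attains the claimed value at `X`, which yields both the formula and the subgradient. -/

theorem le_convexEnvelopeOn {h : E → ℝ} (hh : ConvexOn ℝ S h) (hf : ∀ z ∈ S, h z ≤ f z)
    {x : E} (hx : x ∈ S) : h x ≤ convexEnvelopeOn S f x := by
  refine le_csSup ⟨f x, ?_⟩ ⟨h, hh, hf, rfl⟩
  rintro y ⟨g, -, hg, rfl⟩
  exact hg x hx

/-- The minorant `h₀` keeps the supremum from being over the empty set, where `sSup` takes the
default value `0`. -/
theorem convexEnvelopeOn_le {h₀ : E → ℝ} (hh₀ : ConvexOn ℝ S h₀) (hf₀ : ∀ z ∈ S, h₀ z ≤ f z)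
    {x : E} {C : ℝ} (hC : ∀ h : E → ℝ, ConvexOn ℝ S h → (∀ z ∈ S, h z ≤ f z) → h x ≤ C) :
    convexEnvelopeOn S f x ≤ C := by
  refine csSup_le ⟨_, h₀, hh₀, hf₀, rfl⟩ ?_
  rintro y ⟨g, hg, hgf, rfl⟩
  exact hC g hg hgf

theorem isConvexEnvelopeOn_convexEnvelopeOn {h₀ : E → ℝ} (hh₀ : ConvexOn ℝ S h₀)
    (hf₀ : ∀ z ∈ S, h₀ z ≤ f z) : IsConvexEnvelopeOn S f (convexEnvelopeOn S f) where
  convexOn := by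
    refine ⟨hh₀.1, fun x hx y hy a b ha hb hab => ?_⟩
    refine convexEnvelopeOn_le hh₀ hf₀ fun h hh hf => (hh.2 hx hy ha hb hab).trans ?_
    exact add_le_add (smul_le_smul_of_nonneg_left (le_convexEnvelopeOn hh hf hx) ha)
      (smul_le_smul_of_nonneg_left (le_convexEnvelopeOn hh hf hy) hb)
  le x hx := convexEnvelopeOn_le hh₀ hf₀ fun _ _ hf => hf x hx
  greatest _ hh hf _ hx := le_convexEnvelopeOn hh hf hx

end ConvexEnvelope

/-! ### The hypersimplex -/

/-- A vector with entries in `[0, 1]` and integral sum `m` is a convex combination of indicators of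
`m`-element sets, all of which contain the coordinates where the vector is equal to `1`. -/
theorem mem_convexHull_indicator {ι : Type*} [Fintype ι] [DecidableEq ι] {m : ℕ} (x : ι → ℝ)
    (h0 : ∀ i, 0 ≤ x i) (h1 : ∀ i, x i ≤ 1) (hm : ∑ i, x i = m) :
    x ∈ convexHull ℝ {y : ι → ℝ | ∃ S : Finset ι, S.card = m ∧ (∀ i, x i = 1 → i ∈ S) ∧
      y = fun i => if i ∈ S then 1 else 0} := by
  -- Induction on the number of fractional coordinates.
  induction hn : (Finset.univ.filter fun i => x i ≠ 0 ∧ x i ≠ 1).card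
    using Nat.strong_induction_on generalizing x with
  | _ n ih =>
  by_cases hfrac : ∀ i, x i = 0 ∨ x i = 1
  · refine subset_convexHull ℝ _ ⟨Finset.univ.filter fun i => x i = 1, ?_, by simp, ?_⟩
    · have : ∑ i, x i = ∑ i, if x i = 1 then (1 : ℝ) else 0 :=
        Finset.sum_congr rfl fun i _ => by rcases hfrac i with h | h <;> simp [h]
      rw [this, Finset.sum_boole] at hm
      exact_mod_cast hm
    · funext i
      rcases hfrac i with h | h <;> simp [h]
  push Not at hfrac
  obtain ⟨i, hi0, hi1⟩ := hfrac
  -- A single fractional coordinate would put the integer `m` strictly between `c` and `c + 1`.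
  obtain ⟨j, hji, hj0, hj1⟩ : ∃ j, j ≠ i ∧ x j ≠ 0 ∧ x j ≠ 1 := by
    by_contra! hcon
    have hsum : ∑ j ∈ Finset.univ.erase i, x j
        = ((Finset.univ.erase i).filter fun j => x j = 1).card := by
      rw [← Finset.sum_boole]
      refine Finset.sum_congr rfl fun j hj => ?_
      by_cases h : x j = 0
      · simp [h]
      · simp [hcon j (Finset.ne_of_mem_erase hj) h]
    rw [← Finset.add_sum_erase _ _ (Finset.mem_univ i), hsum] at hm
    have hlo : 0 < x i := lt_of_le_of_ne (h0 i) (Ne.symm hi0)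
    have hhi : x i < 1 := lt_of_le_of_ne (h1 i) hi1
    set c := ((Finset.univ.erase i).filter fun j => x j = 1).card
    have hc1 : (c : ℝ) < m := by linarith
    have hc2 : (m : ℝ) < (c + 1 : ℕ) := by push_cast; linarith
    have hc3 : c < m := by exact_mod_cast hc1
    have hc4 : m < c + 1 := by exact_mod_cast hc2
    omega
  have hlo : ∀ l, x l ≠ 0 → 0 < x l := fun l h => lt_of_le_of_ne (h0 l) (Ne.symm h)
  have hhi : ∀ l, x l ≠ 1 → x l < 1 := fun l h => lt_of_le_of_ne (h1 l) h
  -- Mass moves from `j` to `i` until one of them becomes integral; coordinates equal to `0` or `1`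
  -- stay fixed.
  have key : ∀ i j : ι, i ≠ j → x i ≠ 0 → x i ≠ 1 → x j ≠ 0 → x j ≠ 1 → ∃ t : ℝ, 0 < t ∧
      (x + t • (Pi.single i 1 - Pi.single j 1 : ι → ℝ)) ∈
        convexHull ℝ {y : ι → ℝ | ∃ S : Finset ι, S.card = m ∧ (∀ i, x i = 1 → i ∈ S) ∧
          y = fun i => if i ∈ S then 1 else 0} := by
    intro i j hij hi0 hi1 hj0 hj1
    have htpos : 0 < min (1 - x i) (x j) := lt_min (by linarith [hhi i hi1]) (hlo j hj0)
    refine ⟨min (1 - x i) (x j), htpos, ?_⟩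
    have ht1 : min (1 - x i) (x j) ≤ 1 - x i := min_le_left _ _
    have ht2 : min (1 - x i) (x j) ≤ x j := min_le_right _ _
    have ht3 : min (1 - x i) (x j) = 1 - x i ∨ min (1 - x i) (x j) = x j := min_choice _ _
    generalize min (1 - x i) (x j) = t at *
    set z : ι → ℝ := x + t • (Pi.single i 1 - Pi.single j 1 : ι → ℝ) with hz
    have hzi : z i = x i + t := by simp [hz, hij]
    have hzj : z j = x j - t := by simp [hz, hij.symm, sub_eq_add_neg]
    have hzl : ∀ l, l ≠ i → l ≠ j → z l = x l := fun l h h' => by simp [hz, h, h']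
    have hz1 : ∀ l, x l = 1 → z l = 1 := fun l hl => by
      rw [hzl l (by rintro rfl; exact hi1 hl) (by rintro rfl; exact hj1 hl), hl]
    have hz0 : ∀ l, x l = 0 → z l = 0 := fun l hl => by
      rw [hzl l (by rintro rfl; exact hi0 hl) (by rintro rfl; exact hj0 hl), hl]
    have hmem := ih _ ?_ z ?_ ?_ ?_ rfl
    · refine convexHull_mono ?_ hmem
      rintro y ⟨S, hS, hS', rfl⟩
      exact ⟨S, hS, fun l hl => hS' l (hz1 l hl), rfl⟩
    · rw [← hn]
      refine Finset.card_lt_card (Finset.ssubset_iff_subset_ne.2 ⟨?_, ?_⟩)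
      · intro l
        simp only [Finset.mem_filter, Finset.mem_univ, true_and]
        exact fun h => ⟨mt (hz0 l) h.1, mt (hz1 l) h.2⟩
      · intro heq
        rcases ht3 with h | h
        · have : i ∈ Finset.univ.filter fun i => z i ≠ 0 ∧ z i ≠ 1 := by
            rw [heq]; simp [hi0, hi1]
          simp only [Finset.mem_filter] at this
          exact this.2.2 (by rw [hzi, h]; ring)
        · have : j ∈ Finset.univ.filter fun i => z i ≠ 0 ∧ z i ≠ 1 := by
            rw [heq]; simp [hj0, hj1]
          simp only [Finset.mem_filter] at this
          exact this.2.1 (by rw [hzj, h]; ring)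
    · intro l
      by_cases hli : l = i
      · subst hli; rw [hzi]; linarith [h0 l]
      by_cases hlj : l = j
      · subst hlj; rw [hzj]; linarith
      rw [hzl l hli hlj]; exact h0 l
    · intro l
      by_cases hli : l = i
      · subst hli; rw [hzi]; linarith
      by_cases hlj : l = j
      · subst hlj; rw [hzj]; linarith [h1 l]
      rw [hzl l hli hlj]; exact h1 l
    · simp [hz, Finset.sum_add_distrib, ← Finset.mul_sum, hm]
  obtain ⟨t, ht, hxt⟩ := key i j hji.symm hi0 hi1 hj0 hj1
  obtain ⟨u, hu, hxu⟩ := key j i hji hj0 hj1 hi0 hi1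
  have hconv := convex_convexHull ℝ {y : ι → ℝ | ∃ S : Finset ι, S.card = m ∧
    (∀ i, x i = 1 → i ∈ S) ∧ y = fun i => if i ∈ S then 1 else 0}
  -- The two moves are opposite, of lengths `t` and `u`; these weights cancel them.
  have := hconv hxt hxu (a := u / (t + u)) (b := t / (t + u)) (by positivity) (by positivity)
    (by field_simp; ring)
  convert this using 1
  funext l
  simp only [Pi.add_apply, Pi.smul_apply, Pi.sub_apply, smul_eq_mul]
  field_simp
  ring

/-! ### Break indices -/

section BreakIndex

variable {d m : ℕ} {σ : Fin d → ℝ}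

theorem tailSum_eq_add {η : ℕ} (hη : η < d) : tailSum σ η = σ ⟨η, hη⟩ + tailSum σ (η + 1) := by
  have : (Finset.univ.filter fun i : Fin d => η ≤ i.val)
      = insert ⟨η, hη⟩ (Finset.univ.filter fun i : Fin d => η + 1 ≤ i.val) := by
    ext i
    simp only [Finset.mem_filter, Finset.mem_univ, true_and, Finset.mem_insert, Fin.ext_iff]
    omega
  rw [tailSum, tailSum, this, Finset.sum_insert (by simp)]

theorem tailSum_nonneg (h0 : ∀ i, 0 ≤ σ i) (η : ℕ) : 0 ≤ tailSum σ η :=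
  Finset.sum_nonneg fun i _ => h0 i

theorem one_div_mul_lt_iff_of_lt {η : ℕ} (hη : η < m) (t a : ℝ) :
    1 / ((m : ℝ) - η) * t < a ↔ t < ((m : ℝ) - η) * a := by
  have : (η : ℝ) < m := by exact_mod_cast hη
  rw [one_div, inv_mul_lt_iff₀ (by linarith)]

/-- The defining inequality `σ_{η+1} ≤ T / (m - η)` of a break index, with denominators cleared. -/
theorem isBreakIndex_iff (hmd : m ≤ d) {η : ℕ} :
    IsBreakIndex m σ η ↔ ∃ h : η < m,
      ((m : ℝ) - η) * σ ⟨η, h.trans_le hmd⟩ ≤ tailSum σ η ∧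
      ∀ l (hl : l + 1 = η), tailSum σ l < ((m : ℝ) - l) * σ ⟨l, by omega⟩ := by
  constructor
  · rintro ⟨h, ha, hb⟩
    refine ⟨h, ?_, ?_⟩
    · have := hb ⟨η, h.trans_le hmd⟩ rfl
      rw [← not_lt, one_div_mul_lt_iff_of_lt h] at this
      exact not_lt.1 this
    -- Adding `σ l` to both sides turns the strict inequality at `l + 1` into the failure of the
    -- weak one at `l`.
    · rintro l rfl
      have := ha ⟨l, by omega⟩ rfl
      rw [one_div_mul_lt_iff_of_lt h] at this
      rw [tailSum_eq_add (by omega)]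
      push_cast at this
      linarith
  · rintro ⟨h, hb, ha⟩
    refine ⟨h, ?_, ?_⟩
    · rintro ⟨l, hl'⟩ hl
      rw [one_div_mul_lt_iff_of_lt h]
      have := ha l hl
      subst hl
      rw [tailSum_eq_add hl'] at this
      push_cast
      linarith
    · rintro ⟨l, hl'⟩ rfl
      rw [← not_lt, one_div_mul_lt_iff_of_lt h]
      exact not_lt.2 hb

/-- The weak inequality always holds at `m - 1`, by nonnegativity; the least index satisfying it is
a break index. -/
theorem exists_isBreakIndex (hm : 1 ≤ m) (hmd : m ≤ d) (h0 : ∀ i, 0 ≤ σ i) :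
    ∃ η, IsBreakIndex m σ η := by
  classical
  have hex : ∃ η, ∃ h : η < m, ((m : ℝ) - η) * σ ⟨η, h.trans_le hmd⟩ ≤ tailSum σ η := by
    refine ⟨m - 1, by omega, ?_⟩
    rw [tailSum_eq_add (by omega), Nat.cast_sub hm]
    have := tailSum_nonneg h0 (m - 1 + 1)
    push_cast
    linarith
  refine ⟨Nat.find hex, (isBreakIndex_iff hmd).2 ?_⟩
  obtain ⟨h, hb⟩ := Nat.find_spec hex
  refine ⟨h, hb, fun l hl => ?_⟩
  have := Nat.find_min hex (m := l) (by omega)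
  push Not at this
  exact this (by omega)

/-- By monotonicity of `σ` the weak inequality passes from `l` to `l + 1`, so it cannot fail just
before a later break index. -/
theorem IsBreakIndex.unique (hmd : m ≤ d) (hσ : Antitone σ) {η η' : ℕ}
    (h : IsBreakIndex m σ η) (h' : IsBreakIndex m σ η') : η' = η := by
  have aux : ∀ η η' : ℕ, IsBreakIndex m σ η → IsBreakIndex m σ η' → ¬ η < η' := by
    intro η η' h h' hlt
    rw [isBreakIndex_iff hmd] at h h'
    obtain ⟨hm, hb, -⟩ := h
    obtain ⟨hm', -, ha⟩ := h'
    have step : ∀ l, η ≤ l → ∀ hl : l < m,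
        ((m : ℝ) - l) * σ ⟨l, hl.trans_le hmd⟩ ≤ tailSum σ l := by
      intro l hηl
      induction l, hηl using Nat.le_induction with
      | base => exact fun _ => hb
      | succ l hηl ih =>
        intro hl
        have h1 := ih (by omega)
        rw [tailSum_eq_add (by omega)] at h1
        have h2 : σ ⟨l + 1, hl.trans_le hmd⟩ ≤ σ ⟨l, by omega⟩ := hσ (by simp)
        have h3 : ((l + 1 : ℕ) : ℝ) < m := by exact_mod_cast hl
        push_cast at h3 ⊢
        nlinarith
    obtain ⟨l, rfl⟩ : ∃ l, η' = l + 1 := ⟨η' - 1, by omega⟩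
    exact absurd (ha l rfl) (not_lt.2 (step l (by omega) (by omega)))
  have := aux η η' h h'
  have := aux η' η h' h
  omega

end BreakIndex

/-! ### Spectral facts -/

section Spectral

variable {d : ℕ}

theorem exists_perm_of_map_univ_eq {ι α : Type*} [Fintype ι] [DecidableEq α] {f g : ι → α}
    (h : Finset.univ.val.map f = Finset.univ.val.map g) : ∃ e : Equiv.Perm ι, ∀ i, g (e i) = f i := by
  have hcard : ∀ c, Fintype.card {i // f i = c} = Fintype.card {i // g i = c} := by
    intro c
    have := congrArg (Multiset.count c) h
    rw [Multiset.count_map, Multiset.count_map] at this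
    rw [Fintype.card_subtype, Fintype.card_subtype]
    simpa [Finset.card_def, eq_comm] using this
  exact ⟨Equiv.ofFiberEquiv fun c => Fintype.equivOfCardEq (hcard c),
    fun i => Equiv.ofFiberEquiv_map _ i⟩

theorem sortedEigenvalues_antitone {X : Matrix (Fin d) (Fin d) ℝ} (hX : X.IsHermitian) :
    Antitone (sortedEigenvalues hX) :=
  fun _ _ hij => hX.eigenvalues₀_antitone hij

theorem transpose_mul_self_of_mem_orthogonalGroup {Q : Matrix (Fin d) (Fin d) ℝ}
    (hQ : Q ∈ Matrix.orthogonalGroup (Fin d) ℝ) : Qᵀ * Q = 1 := by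
  simpa [Matrix.star_eq_conjTranspose, Matrix.conjTranspose_eq_transpose_of_trivial] using
    (Matrix.mem_orthogonalGroup_iff' (Fin d) ℝ).1 hQ

theorem isHermitian_conj_diagonal (Q : Matrix (Fin d) (Fin d) ℝ) (τ : Fin d → ℝ) :
    (Q * Matrix.diagonal τ * Qᵀ).IsHermitian := by
  simp [Matrix.IsHermitian, Matrix.conjTranspose_eq_transpose_of_trivial, Matrix.transpose_mul,
    Matrix.mul_assoc]

theorem posSemidef_conj_diagonal (Q : Matrix (Fin d) (Fin d) ℝ) {τ : Fin d → ℝ}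
    (h0 : ∀ i, 0 ≤ τ i) : (Q * Matrix.diagonal τ * Qᵀ).PosSemidef := by
  rw [← Matrix.conjTranspose_eq_transpose_of_trivial]
  exact (Matrix.posSemidef_diagonal_iff.2 h0).mul_mul_conjTranspose_same Q

/-- Both families list the roots of the characteristic polynomial with multiplicity. -/
theorem exists_perm_sortedEigenvalues {X Q : Matrix (Fin d) (Fin d) ℝ} {τ : Fin d → ℝ}
    (hQ : Q ∈ Matrix.orthogonalGroup (Fin d) ℝ) (hX : X.IsHermitian)
    (h : X = Q * Matrix.diagonal τ * Qᵀ) :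
    ∃ e : Equiv.Perm (Fin d), ∀ i, sortedEigenvalues hX (e i) = τ i := by
  have hQ' := transpose_mul_self_of_mem_orthogonalGroup hQ
  have hroots : X.charpoly.roots = Finset.univ.val.map τ := by
    rw [h, Matrix.charpoly_mul_comm, ← Matrix.mul_assoc, hQ', Matrix.one_mul,
      Matrix.charpoly_diagonal]
    have := Polynomial.roots_multiset_prod_X_sub_C (Finset.univ.val.map τ)
    rwa [Multiset.map_map] at this
  apply exists_perm_of_map_univ_eq
  rw [← hroots, hX.roots_charpoly_eq_eigenvalues₀]
  have : (Finset.univ : Finset (Fin (Fintype.card (Fin d)))).val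
      = Finset.univ.val.map (Fin.cast (Fintype.card_fin d).symm) :=
    congrArg Finset.val (Finset.map_univ_equiv (finCongr (Fintype.card_fin d).symm)).symm
  rw [this, Multiset.map_map]
  rfl

theorem exists_orthogonal_eq_conj_eigenvalues {X : Matrix (Fin d) (Fin d) ℝ} (hX : X.IsHermitian) :
    ∃ V ∈ Matrix.orthogonalGroup (Fin d) ℝ,
      X = V * Matrix.diagonal hX.eigenvalues * Vᵀ := by
  refine ⟨hX.eigenvectorUnitary, SetLike.coe_mem _, ?_⟩
  conv_lhs => rw [hX.spectral_theorem]
  simp [Unitary.conjStarAlgAut_apply, Matrix.star_eq_conjTranspose,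
    Matrix.conjTranspose_eq_transpose_of_trivial]

theorem sortedEigenvalues_nonneg {X : Matrix (Fin d) (Fin d) ℝ} (hX : X.PosSemidef) (i : Fin d) :
    0 ≤ sortedEigenvalues hX.isHermitian i := by
  obtain ⟨V, hV, hXV⟩ := exists_orthogonal_eq_conj_eigenvalues hX.isHermitian
  obtain ⟨e, he⟩ := exists_perm_sortedEigenvalues hV hX.isHermitian hXV
  rw [← e.apply_symm_apply i, he]
  exact hX.eigenvalues_nonneg _

theorem nonneg_of_posSemidef_conj {X Q : Matrix (Fin d) (Fin d) ℝ} {τ : Fin d → ℝ}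
    (hQ : Q ∈ Matrix.orthogonalGroup (Fin d) ℝ) (hX : X.PosSemidef)
    (h : X = Q * Matrix.diagonal τ * Qᵀ) (i : Fin d) : 0 ≤ τ i := by
  have hQ' := transpose_mul_self_of_mem_orthogonalGroup hQ
  have h1 := hX.conjTranspose_mul_mul_same Q
  have h2 : Qᴴ * X * Q = Matrix.diagonal τ := by
    rw [h, Matrix.conjTranspose_eq_transpose_of_trivial]
    calc Qᵀ * (Q * Matrix.diagonal τ * Qᵀ) * Q
        = (Qᵀ * Q) * Matrix.diagonal τ * (Qᵀ * Q) := by simp only [Matrix.mul_assoc]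
      _ = _ := by rw [hQ', Matrix.one_mul, Matrix.mul_one]
  rw [h2, Matrix.posSemidef_diagonal_iff] at h1
  exact h1 i

theorem sum_initial_le_sum {m : ℕ} (hm : 1 ≤ m) (hmd : m ≤ d) {g : Fin d → ℝ} (hg : Monotone g)
    {S : Finset (Fin d)} (hS : S.card = m) :
    ∑ i : Fin d with i.val < m, g i ≤ ∑ i ∈ S, g i := by
  set I : Finset (Fin d) := Finset.univ.filter fun i => i.val < m with hI
  have hIc : I.card = m := by
    rw [hI, Fin.card_filter_val_lt, min_eq_right hmd]
  -- Subtracting the threshold `c` changes both sums by `m * c`; afterwards terms are nonpositive on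
  -- `I` and nonnegative off it.
  set c := g ⟨m - 1, by omega⟩
  have hlow : ∀ i ∈ I, g i - c ≤ 0 := fun i hi => by
    have hi' : i.val < m := by simpa [hI] using hi
    exact sub_nonpos.2 (hg (by rw [Fin.le_def]; simp only; omega))
  have hhigh : ∀ i, i ∉ I → 0 ≤ g i - c := fun i hi => by
    have hi' : ¬ i.val < m := by simpa [hI] using hi
    exact sub_nonneg.2 (hg (by rw [Fin.le_def]; simp only; omega))
  have h1 : ∑ i ∈ I, (g i - c) ≤ ∑ i ∈ I ∩ S, (g i - c) := by
    have := Finset.sum_inter_add_sum_sdiff I S (fun i => g i - c)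
    have h2 : ∑ i ∈ I \ S, (g i - c) ≤ 0 :=
      Finset.sum_nonpos fun i hi => hlow i (Finset.mem_sdiff.1 hi).1
    linarith
  have h2 : ∑ i ∈ I ∩ S, (g i - c) ≤ ∑ i ∈ S, (g i - c) := by
    refine Finset.sum_le_sum_of_subset_of_nonneg Finset.inter_subset_right fun i hi hi' => ?_
    exact hhigh i fun h => hi' (Finset.mem_inter.2 ⟨h, hi⟩)
  have h3 := h1.trans h2
  simp only [Finset.sum_sub_distrib, Finset.sum_const, hIc, hS] at h3
  linarith

/-- Since `1 / (t + lam)` decreases in `t`, the `m` largest eigenvalues give the least sum over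
`m`-element sets. -/
theorem Gam_conj_diagonal_le {m : ℕ} (hm : 1 ≤ m) (hmd : m ≤ d) {lam : ℝ} (hlam : 0 < lam)
    {Q : Matrix (Fin d) (Fin d) ℝ} {τ : Fin d → ℝ} (hQ : Q ∈ Matrix.orthogonalGroup (Fin d) ℝ)
    (h0 : ∀ i, 0 ≤ τ i) {S : Finset (Fin d)} (hS : S.card = m) :
    Gam m lam (Q * Matrix.diagonal τ * Qᵀ) ≤ ∑ i ∈ S, 1 / (τ i + lam) := by
  have hX := isHermitian_conj_diagonal Q τ
  rw [Gam, dif_pos hX]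
  obtain ⟨e, he⟩ := exists_perm_sortedEigenvalues hQ hX rfl
  have hnn : ∀ i, 0 ≤ sortedEigenvalues hX i := fun i => by
    rw [← e.apply_symm_apply i, he]; exact h0 _
  have hmono : Monotone fun i => 1 / (sortedEigenvalues hX i + lam) := fun i j hij => by
    have := sortedEigenvalues_antitone hX hij
    exact one_div_le_one_div_of_le (by linarith [hnn j]) (by linarith)
  have := sum_initial_le_sum hm hmd hmono (S := S.map e.toEmbedding) (by simpa using hS)
  simpa [he] using this

theorem mul_self_mem_doublyStochastic {U : Matrix (Fin d) (Fin d) ℝ}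
    (hU : U ∈ Matrix.orthogonalGroup (Fin d) ℝ) :
    (Matrix.of fun i j => U i j * U i j) ∈ doublyStochastic ℝ (Fin d) := by
  have h1 := (Matrix.mem_orthogonalGroup_iff (Fin d) ℝ).1 hU
  have h2 := (Matrix.mem_orthogonalGroup_iff' (Fin d) ℝ).1 hU
  rw [mem_doublyStochastic_iff_sum]
  refine ⟨fun i j => mul_self_nonneg _, fun i => ?_, fun j => ?_⟩
  · simpa [Matrix.mul_apply] using congrFun (congrFun h1 i) i
  · simpa [Matrix.mul_apply] using congrFun (congrFun h2 j) j

/-- Birkhoff's theorem reduces this linear inequality to permutation matrices, where it is the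
rearrangement inequality. -/
theorem sum_mul_le_of_mem_doublyStochastic {M : Matrix (Fin d) (Fin d) ℝ}
    (hM : M ∈ doublyStochastic ℝ (Fin d)) {w μ : Fin d → ℝ} (hw : Monotone w) (hμ : Antitone μ)
    (e : Equiv.Perm (Fin d)) :
    ∑ i, w i * μ i ≤ ∑ i, ∑ j, w i * (M i j * μ (e j)) := by
  have hlin : IsLinearMap ℝ fun M : Matrix (Fin d) (Fin d) ℝ =>
      ∑ i, ∑ j, w i * (M i j * μ (e j)) := by
    constructor
    · intro A B
      simp only [Matrix.add_apply, ← Finset.sum_add_distrib]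
      exact Finset.sum_congr rfl fun i _ => Finset.sum_congr rfl fun j _ => by ring
    · intro c A
      simp only [Matrix.smul_apply, smul_eq_mul, Finset.mul_sum]
      exact Finset.sum_congr rfl fun i _ => Finset.sum_congr rfl fun j _ => by ring
  have hsub : (doublyStochastic ℝ (Fin d) : Set (Matrix (Fin d) (Fin d) ℝ)) ⊆
      {M | ∑ i, w i * μ i ≤ ∑ i, ∑ j, w i * (M i j * μ (e j))} := by
    rw [doublyStochastic_eq_convexHull_permMatrix]
    refine convexHull_min ?_ (convex_halfSpace_ge hlin _)
    rintro _ ⟨π, rfl⟩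
    have hperm : ∑ i, ∑ j, w i * (π.permMatrix ℝ i j * μ (e j)) = ∑ i, w i * μ ((π.trans e) i) := by
      refine Finset.sum_congr rfl fun i _ => ?_
      rw [← Finset.mul_sum]
      have := congrFun (Matrix.permMatrix_mulVec (σ := π) (v := fun j => μ (e j))) i
      rw [Matrix.mulVec, dotProduct] at this
      rw [this]; rfl
    rw [Set.mem_ofPred_eq, hperm]
    exact (hw.antivary hμ).sum_smul_le_sum_smul_comp_perm (σ := π.trans e)
  exact hsub hM

/-- A lower bound for the trace of a product: eigenvalues are paired in opposite order. -/
theorem sum_mul_sortedEigenvalues_le_trace {Y Q : Matrix (Fin d) (Fin d) ℝ} (hY : Y.IsHermitian)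
    (hQ : Q ∈ Matrix.orthogonalGroup (Fin d) ℝ) {w : Fin d → ℝ} (hw : Monotone w) :
    ∑ i, w i * sortedEigenvalues hY i ≤ (Q * Matrix.diagonal w * Qᵀ * Y).trace := by
  obtain ⟨V, hV, hYV⟩ := exists_orthogonal_eq_conj_eigenvalues hY
  obtain ⟨e, he⟩ := exists_perm_sortedEigenvalues hV hY hYV
  have hQt : Qᵀ ∈ Matrix.orthogonalGroup (Fin d) ℝ := by
    simpa [Matrix.star_eq_conjTranspose, Matrix.conjTranspose_eq_transpose_of_trivial] using
      Unitary.star_mem hQ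
  have hU : Qᵀ * V ∈ Matrix.orthogonalGroup (Fin d) ℝ := mul_mem hQt hV
  -- In the two eigenbases the trace has as weights the squared entries of the orthogonal matrix `Qᵀ
  -- * V`, which are doubly stochastic.
  have htr : (Q * Matrix.diagonal w * Qᵀ * Y).trace
      = ∑ i, ∑ j, w i * ((Qᵀ * V) i j * (Qᵀ * V) i j * hY.eigenvalues j) := by
    calc (Q * Matrix.diagonal w * Qᵀ * Y).trace
        = (Q * (Matrix.diagonal w * Qᵀ * (V * Matrix.diagonal hY.eigenvalues * Vᵀ))).trace := by
          conv_lhs => rw [hYV]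
          simp only [Matrix.mul_assoc]
      _ = (Matrix.diagonal w * ((Qᵀ * V) * Matrix.diagonal hY.eigenvalues * (Qᵀ * V)ᵀ)).trace := by
          rw [Matrix.trace_mul_comm, Matrix.transpose_mul, Matrix.transpose_transpose]
          simp only [Matrix.mul_assoc]
      _ = _ := by
          simp only [Matrix.trace, Matrix.diag_apply, Matrix.diagonal_mul, Matrix.mul_apply (N := (Qᵀ * V)ᵀ),
            Matrix.mul_diagonal, Matrix.transpose_apply (Qᵀ * V), Finset.mul_sum]
          exact Finset.sum_congr rfl fun i _ => Finset.sum_congr rfl fun j _ => by ring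
  rw [htr]
  simpa [he] using sum_mul_le_of_mem_doublyStochastic (mul_self_mem_doublyStochastic hU) hw
    (sortedEigenvalues_antitone hY) e

end Spectral

/-! ### The envelope of `Gam` -/

/-- The eigenvalues of `X` with all those from position `η` on replaced by `T / (m - η)`, where
`T` is their sum. -/
noncomputable def levelled {d : ℕ} (m : ℕ) (σ : Fin d → ℝ) (η : ℕ) (i : Fin d) : ℝ :=
  if i.val < η then σ i else tailSum σ η / ((m : ℝ) - η)

section Levelled

variable {d m η : ℕ} {σ : Fin d → ℝ} {lam : ℝ}

theorem levelled_nonneg (hη : η < m) (h0 : ∀ i, 0 ≤ σ i) (i : Fin d) : 0 ≤ levelled m σ η i := by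
  have : (η : ℝ) < m := by exact_mod_cast hη
  unfold levelled
  split_ifs
  · exact h0 i
  · exact div_nonneg (tailSum_nonneg h0 η) (by linarith)

/-- The strict break inequality places the level below the last kept entry. This orders the slope
weights as the trace inequality requires. -/
theorem IsBreakIndex.levelled_antitone (hmd : m ≤ d) (hσ : Antitone σ)
    (h : IsBreakIndex m σ η) : Antitone (levelled m σ η) := by
  intro i j hij
  rw [Fin.le_def] at hij
  unfold levelled
  split_ifs with hj hi hi
  · exact hσ hij
  · omega
  · have hlt := h.lt
    have h1 := h.above ⟨η - 1, by omega⟩ (by simp only; omega)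
    have h2 : σ ⟨η - 1, by omega⟩ ≤ σ i := hσ (by rw [Fin.le_def]; simp only; omega)
    rw [one_div, inv_mul_eq_div] at h1
    linarith
  · exact le_rfl

theorem IsBreakIndex.le_level (hσ : Antitone σ) (h : IsBreakIndex m σ η)
    {i : Fin d} (hi : η ≤ i.val) : σ i ≤ tailSum σ η / ((m : ℝ) - η) := by
  have h1 := h.below ⟨η, by omega⟩ rfl
  rw [one_div, inv_mul_eq_div] at h1
  exact (hσ (by rw [Fin.le_def]; exact hi)).trans h1

/-- A sum over an `m`-element set containing the first `η` indices, split at `η`. -/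
theorem sum_levelled (hη : η < m) {S : Finset (Fin d)} (hmd : m ≤ d) (hS : S.card = m)
    (hsub : ∀ i : Fin d, i.val < η → i ∈ S) (f : ℝ → ℝ) :
    ∑ i ∈ S, f (levelled m σ η i) = ∑ i : Fin d with i.val < η, f (σ i)
      + ((m : ℝ) - η) * f (tailSum σ η / ((m : ℝ) - η)) := by
  have hIS : (Finset.univ.filter fun i : Fin d => i.val < η) ⊆ S := fun i hi =>
    hsub i (by simpa using hi)
  have hcard : ((S \ Finset.univ.filter fun i : Fin d => i.val < η).card : ℝ) = (m : ℝ) - η := by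
    rw [Finset.card_sdiff_of_subset hIS, hS, Fin.card_filter_val_lt, min_eq_right (by omega),
      Nat.cast_sub hη.le]
  rw [← Finset.sum_sdiff hIS, add_comm]
  congr 1
  · refine Finset.sum_congr rfl fun i hi => ?_
    rw [levelled, if_pos (by simpa using hi)]
  · rw [← hcard, ← nsmul_eq_mul, ← Finset.sum_const]
    refine Finset.sum_congr rfl fun i hi => ?_
    have hi' : ¬ i.val < η := by simpa using (Finset.mem_sdiff.1 hi).2
    rw [levelled, if_neg hi', hcard]

theorem level_div_eq (hη : η < m) (t lam : ℝ) :
    ((m : ℝ) - η) / (t + ((m : ℝ) - η) * lam) = 1 / (t / ((m : ℝ) - η) + lam) := by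
  have : (η : ℝ) < m := by exact_mod_cast hη
  have h : (m : ℝ) - η ≠ 0 := by linarith
  rw [div_add' _ _ _ h, one_div_div, mul_comm lam]

theorem envelopeValue_eq (hη : η < m) (hmd : m ≤ d) {S : Finset (Fin d)} (hS : S.card = m)
    (hsub : ∀ i : Fin d, i.val < η → i ∈ S) :
    envelopeValue m lam σ η = ∑ i ∈ S, 1 / (levelled m σ η i + lam) := by
  rw [sum_levelled hη hmd hS hsub fun t => 1 / (t + lam), ← level_div_eq hη, envelopeValue]
  ring

theorem subgradValue_eq (hη : η < m) (i : Fin d) :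
    subgradValue m lam σ η i = -(1 / (levelled m σ η i + lam)) ^ 2 := by
  unfold subgradValue levelled
  split_ifs
  · rfl
  · rw [level_div_eq hη]

end Levelled

/-! ### Matching upper and lower bounds for the envelope -/

section Bounds

variable {d m η : ℕ} {σ : Fin d → ℝ} {lam : ℝ} {Q : Matrix (Fin d) (Fin d) ℝ}

theorem card_initial (hmd : m ≤ d) : (Finset.univ.filter fun i : Fin d => i.val < m).card = m := by
  rw [Fin.card_filter_val_lt, min_eq_right hmd]

/-- Every convex function below `Gam` is bounded by `envelopeValue`: `X` is a convex combination of
matrices whose spectrum is `levelled` on an `m`-element set and `0` off it. -/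
theorem le_envelopeValue_of_convexOn (hmd : m ≤ d) (hlam : 0 < lam)
    (hQ : Q ∈ Matrix.orthogonalGroup (Fin d) ℝ) (hσ : Antitone σ) (h0 : ∀ i, 0 ≤ σ i)
    (hη : IsBreakIndex m σ η) {h : Matrix (Fin d) (Fin d) ℝ → ℝ} (hh : ConvexOn ℝ (psdCone d) h)
    (hle : ∀ Z ∈ psdCone d, h Z ≤ Gam m lam Z) :
    h (Q * Matrix.diagonal σ * Qᵀ) ≤ envelopeValue m lam σ η := by
  have hlt : (η : ℝ) < m := by exact_mod_cast hη.lt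
  have hs := tailSum_nonneg h0 η
  obtain ⟨x, hx0, hx1, hxsum, hxη, hxσ⟩ : ∃ x : Fin d → ℝ, (∀ i, 0 ≤ x i) ∧ (∀ i, x i ≤ 1) ∧
      ∑ i, x i = m ∧ (∀ i : Fin d, i.val < η → x i = 1) ∧
      ∀ i, levelled m σ η i * x i = σ i := by
    rcases hs.eq_or_lt with hs | hs
    -- With zero tail the level is `0` and the ratio is meaningless; the indicator of any
    -- `m`-element set containing the head would do.
    · refine ⟨fun i => if i.val < m then 1 else 0, fun i => by dsimp only; split_ifs <;> simp,
        fun i => by dsimp only; split_ifs <;> simp, ?_, fun i hi => if_pos (hi.trans hη.lt), fun i => ?_⟩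
      · rw [Finset.sum_boole, card_initial hmd]
      · by_cases hi : i.val < η
        · simp [levelled, hi, hi.trans hη.lt]
        · have := hη.le_level hσ (not_lt.1 hi)
          rw [← hs, zero_div] at this
          rw [levelled, if_neg hi, ← hs, zero_div, zero_mul]
          exact le_antisymm (h0 i) this
    · have hpos : 0 < tailSum σ η / ((m : ℝ) - η) := div_pos hs (by linarith)
      refine ⟨fun i => if i.val < η then 1 else σ i / (tailSum σ η / ((m : ℝ) - η)), fun i => ?_,
        fun i => ?_, ?_, fun i hi => if_pos hi, fun i => ?_⟩
      · dsimp only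
        split_ifs
        · simp
        · exact div_nonneg (h0 i) hpos.le
      · dsimp only
        split_ifs with hi
        · exact le_rfl
        · exact (div_le_one hpos).2 (hη.le_level hσ (not_lt.1 hi))
      · rw [Finset.sum_ite, Finset.sum_const, card_initial (hη.lt.le.trans hmd),
          ← Finset.sum_div]
        simp only [not_lt]
        change η • (1 : ℝ) + tailSum σ η / _ = _
        rw [div_div_cancel₀ hs.ne']
        simp
      · by_cases hi : i.val < η
        · simp [levelled, hi]
        · simp only [levelled, if_neg hi]
          exact mul_div_cancel₀ _ hpos.ne'
  set Z : (Fin d → ℝ) → Matrix (Fin d) (Fin d) ℝ := fun y =>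
    Q * Matrix.diagonal (fun i => levelled m σ η i * y i) * Qᵀ with hZ
  have hZcomb : ∀ (a b : ℝ) (y z : Fin d → ℝ), Z (a • y + b • z) = a • Z y + b • Z z := by
    intro a b y z
    have : (Matrix.diagonal fun i => levelled m σ η i * (a • y + b • z) i)
        = a • Matrix.diagonal (fun i => levelled m σ η i * y i)
          + b • Matrix.diagonal (fun i => levelled m σ η i * z i) := by
      rw [← Matrix.diagonal_smul, ← Matrix.diagonal_smul, Matrix.diagonal_add]
      congr 1
      funext i
      simp only [Pi.add_apply, Pi.smul_apply, smul_eq_mul]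
      ring
    simp only [hZ, this, Matrix.mul_add, Matrix.add_mul, Matrix.mul_smul, Matrix.smul_mul]
  have hlev := levelled_nonneg hη.lt h0
  have hmem := mem_convexHull_indicator x hx0 hx1 hxsum
  -- `Z` is linear, so the preimage of a sublevel set of `h` is convex; only indicators remain to be
  -- checked.
  have hconv : Convex ℝ {y : Fin d → ℝ | Z y ∈ psdCone d ∧ h (Z y) ≤ envelopeValue m lam σ η} := by
    intro y hy z hz a b ha hb hab
    change Z _ ∈ _ ∧ h (Z _) ≤ _
    rw [hZcomb]
    exact hh.convex_le _ hy hz ha hb hab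
  have hsub := convexHull_min (s := {y : Fin d → ℝ | ∃ S : Finset (Fin d), S.card = m ∧
      (∀ i, x i = 1 → i ∈ S) ∧ y = fun i => if i ∈ S then 1 else 0}) (𝕜 := ℝ) ?_ hconv hmem
  · have := hsub.2
    simpa only [hZ, hxσ] using this
  rintro y ⟨S, hS, hSx, rfl⟩
  have hnn : ∀ i, 0 ≤ levelled m σ η i * (if i ∈ S then (1 : ℝ) else 0) := fun i =>
    mul_nonneg (hlev i) (by split_ifs <;> simp)
  have hpsd : Z (fun i => if i ∈ S then 1 else 0) ∈ psdCone d := posSemidef_conj_diagonal Q hnn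
  refine ⟨hpsd, (hle _ hpsd).trans ?_⟩
  rw [envelopeValue_eq hη.lt hmd hS fun i hi => hSx i (hxη i hi)]
  refine (Gam_conj_diagonal_le (Nat.one_le_of_lt hη.lt) hmd hlam hQ hnn hS).trans_eq ?_
  exact Finset.sum_congr rfl fun i hi => by rw [if_pos hi, mul_one]

/-- For `a > 0` this is the tangent line to `1 / x` at `x = 1 / a`; the gap is a square over `x`. -/
theorem two_mul_sub_le {a x : ℝ} (hx : 0 < x) : 2 * a ≤ 1 / x + a ^ 2 * x := by
  have : 1 / x + a ^ 2 * x - 2 * a = (1 - a * x) ^ 2 / x := by field_simp; ring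
  have : 0 ≤ (1 - a * x) ^ 2 / x := by positivity
  linarith

/-- The affine function with slope given by `subgradValue` that touches the envelope at `X` lies
below `Gam`. -/
theorem envelopeValue_add_trace_le (hmd : m ≤ d) (hlam : 0 < lam)
    (hQ : Q ∈ Matrix.orthogonalGroup (Fin d) ℝ) (hσ : Antitone σ) (h0 : ∀ i, 0 ≤ σ i)
    (hη : IsBreakIndex m σ η) {Y : Matrix (Fin d) (Fin d) ℝ} (hY : Y ∈ psdCone d) :
    envelopeValue m lam σ η + (Q * Matrix.diagonal (subgradValue m lam σ η) * Qᵀ *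
      (Y - Q * Matrix.diagonal σ * Qᵀ)).trace ≤ Gam m lam Y := by
  have hlt : (η : ℝ) < m := by exact_mod_cast hη.lt
  have hlev := levelled_nonneg hη.lt h0
  set a : Fin d → ℝ := fun i => 1 / (levelled m σ η i + lam) with ha
  have hapos : ∀ i, 0 < a i := fun i => one_div_pos.2 (by linarith [hlev i])
  have hamono : Monotone a := fun i j hij =>
    one_div_le_one_div_of_le (by linarith [hlev j])
      (by linarith [hη.levelled_antitone hmd hσ hij])
  have hw : Monotone fun i => a i ^ 2 := fun i j hij =>
    pow_le_pow_left₀ (hapos i).le (hamono hij) 2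
  have hQ' := transpose_mul_self_of_mem_orthogonalGroup hQ
  have hsub : Matrix.diagonal (subgradValue m lam σ η) = -Matrix.diagonal fun i => a i ^ 2 := by
    rw [Matrix.diagonal_neg]
    congr 1
    funext i
    exact subgradValue_eq hη.lt i
  have htrX : (Q * Matrix.diagonal (fun i => a i ^ 2) * Qᵀ *
      (Q * Matrix.diagonal σ * Qᵀ)).trace = ∑ i, a i ^ 2 * σ i := by
    calc _ = (Q * (Matrix.diagonal (fun i => a i ^ 2) * ((Qᵀ * Q) * Matrix.diagonal σ * Qᵀ))).trace :=
          by simp only [Matrix.mul_assoc]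
      _ = (Matrix.diagonal (fun i => a i ^ 2) * Matrix.diagonal σ * (Qᵀ * Q)).trace := by
          rw [Matrix.trace_mul_comm, hQ', Matrix.one_mul]
          simp only [Matrix.mul_assoc, hQ', Matrix.mul_one]
      _ = _ := by rw [hQ', Matrix.mul_one, Matrix.diagonal_mul_diagonal, Matrix.trace_diagonal]
  have hY' : Y.PosSemidef := hY
  have htrY := sum_mul_sortedEigenvalues_le_trace hY'.isHermitian hQ hw
  have hμ : ∀ i, 0 ≤ sortedEigenvalues hY'.isHermitian i := sortedEigenvalues_nonneg hY'
  set μ := sortedEigenvalues hY'.isHermitian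
  have hIc := card_initial (m := m) hmd
  have hIsub : ∀ i : Fin d, i.val < η → i ∈ Finset.univ.filter fun i : Fin d => i.val < m :=
    fun i hi => by simpa using hi.trans hη.lt
  have hE := envelopeValue_eq (lam := lam) (σ := σ) hη.lt hmd hIc hIsub
  have hG : Gam m lam Y = ∑ i : Fin d with i.val < m, 1 / (μ i + lam) := by
    rw [Gam, dif_pos hY'.isHermitian]
  -- The weight `a i ^ 2` is constant on the tail, so only the tail sum matters, and levelling on
  -- the first `m` positions preserves it.
  have hX : ∑ i, a i ^ 2 * σ i
      = ∑ i : Fin d with i.val < m, a i ^ 2 * levelled m σ η i := by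
    have hb : ((m : ℝ) - η) ≠ 0 := by linarith
    rw [sum_levelled hη.lt hmd hIc hIsub fun t => (1 / (t + lam)) ^ 2 * t,
      ← Finset.sum_filter_add_sum_filter_not Finset.univ fun i : Fin d => i.val < η]
    congr 1
    · refine Finset.sum_congr rfl fun i hi => ?_
      have hi' : i.val < η := by simpa using hi
      simp only [ha, levelled, if_pos hi']
    · rw [mul_left_comm, mul_div_cancel₀ _ hb, tailSum, Finset.mul_sum]
      simp only [not_lt]
      refine Finset.sum_congr rfl fun i hi => ?_
      have hi' : ¬ i.val < η := by simpa using hi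
      simp only [ha, levelled, if_neg hi', tailSum]
  -- The trace involves all `d` eigenvalues of `Y`, but `Gam` only `m`; the extra terms are
  -- nonnegative.
  have hYhead : ∑ i : Fin d with i.val < m, a i ^ 2 * μ i ≤ ∑ i, a i ^ 2 * μ i :=
    Finset.sum_le_sum_of_subset_of_nonneg (Finset.filter_subset _ _)
      fun i _ _ => mul_nonneg (sq_nonneg _) (hμ i)
  have hpt : ∑ i : Fin d with i.val < m, (a i + a i ^ 2 * levelled m σ η i)
      ≤ ∑ i : Fin d with i.val < m, (1 / (μ i + lam) + a i ^ 2 * μ i) := by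
    refine Finset.sum_le_sum fun i _ => ?_
    have h1 := two_mul_sub_le (a := a i) (x := μ i + lam) (by linarith [hμ i])
    have h2 : a i ^ 2 * (levelled m σ η i + lam) = a i := by
      have : levelled m σ η i + lam ≠ 0 := by linarith [hlev i]
      simp only [ha]
      field_simp
    linarith
  rw [Finset.sum_add_distrib, Finset.sum_add_distrib] at hpt
  rw [hsub, Matrix.mul_neg, Matrix.neg_mul, Matrix.neg_mul, Matrix.trace_neg, Matrix.mul_sub,
    Matrix.trace_sub, htrX, hX, hE, hG]
  linarith

theorem convex_psdCone (d : ℕ) : Convex ℝ (psdCone d) := fun _ hX _ hY _ _ ha hb _ =>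
  (hX.smul ha).add (hY.smul hb)

theorem Gam_nonneg (hlam : 0 < lam) {X : Matrix (Fin d) (Fin d) ℝ} (hX : X ∈ psdCone d) :
    0 ≤ Gam m lam X := by
  have hX' : X.PosSemidef := hX
  rw [Gam, dif_pos hX'.isHermitian]
  refine Finset.sum_nonneg fun i _ => one_div_nonneg.2 (add_nonneg (sortedEigenvalues_nonneg hX' i) hlam.le)

theorem convexOn_add_trace_mul_sub (c : ℝ) (W X : Matrix (Fin d) (Fin d) ℝ) :
    ConvexOn ℝ (psdCone d) fun Y => c + (W * (Y - X)).trace := by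
  refine ⟨convex_psdCone d, fun Y _ Z _ a b _ _ hab => le_of_eq ?_⟩
  simp only [Matrix.mul_sub, Matrix.mul_add, Matrix.mul_smul, Matrix.trace_sub, Matrix.trace_add,
    Matrix.trace_smul, smul_eq_mul]
  linear_combination (-(c - (W * X).trace)) * hab

end Bounds

theorem proposition3 (d k : ℕ) (hd : 1 ≤ d) (hk : 1 ≤ k) (lam : ℝ) (hlam : 0 < lam) :
    IsConvexEnvelopeOn (psdCone d) (Gam (min k d) lam)
        (convexEnvelopeOn (psdCone d) (Gam (min k d) lam)) ∧
      ∀ (X Q : Matrix (Fin d) (Fin d) ℝ) (σ : Fin d → ℝ),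
        X ∈ psdCone d → IsEigenDecomposition X Q σ →
          ∃ η : ℕ,
            (IsBreakIndex (min k d) σ η ∧ ∀ η' : ℕ, IsBreakIndex (min k d) σ η' → η' = η) ∧
            convexEnvelopeOn (psdCone d) (Gam (min k d) lam) X
              = envelopeValue (min k d) lam σ η ∧
            IsSubgradient (convexEnvelopeOn (psdCone d) (Gam (min k d) lam)) X
              (Q * Matrix.diagonal (subgradValue (min k d) lam σ η) * Qᵀ) := by
  have hmd : min k d ≤ d := min_le_right _ _
  have hm : 1 ≤ min k d := le_min hk hd
  have hz : ConvexOn ℝ (psdCone d) fun _ => (0 : ℝ) := convexOn_const 0 (convex_psdCone d)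
  have hz' : ∀ Z ∈ psdCone d, (0 : ℝ) ≤ Gam (min k d) lam Z := fun Z hZ => Gam_nonneg hlam hZ
  refine ⟨isConvexEnvelopeOn_convexEnvelopeOn hz hz', ?_⟩
  rintro X Q σ hX ⟨hQ, hσ, rfl⟩
  have h0 := nonneg_of_posSemidef_conj hQ hX rfl
  obtain ⟨η, hη⟩ := exists_isBreakIndex hm hmd h0
  have hsymm : (Q * Matrix.diagonal (subgradValue (min k d) lam σ η) * Qᵀ).IsSymm := by
    rw [Matrix.IsSymm, ← Matrix.conjTranspose_eq_transpose_of_trivial]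
    exact isHermitian_conj_diagonal Q _
  have hlow : ∀ Y ∈ psdCone d, envelopeValue (min k d) lam σ η +
      (Q * Matrix.diagonal (subgradValue (min k d) lam σ η) * Qᵀ *
        (Y - Q * Matrix.diagonal σ * Qᵀ)).trace
      ≤ convexEnvelopeOn (psdCone d) (Gam (min k d) lam) Y := fun Y hY =>
    le_convexEnvelopeOn (convexOn_add_trace_mul_sub _ _ _)
      (fun Z hZ => envelopeValue_add_trace_le hmd hlam hQ hσ h0 hη hZ) hY
  have hval : convexEnvelopeOn (psdCone d) (Gam (min k d) lam) (Q * Matrix.diagonal σ * Qᵀ)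
      = envelopeValue (min k d) lam σ η := by
    refine le_antisymm (convexEnvelopeOn_le hz hz' fun h hh hle =>
      le_envelopeValue_of_convexOn hmd hlam hQ hσ h0 hη hh hle) ?_
    -- At `Y = X` the trace term vanishes.
    simpa using hlow _ hX
  refine ⟨η, ⟨hη, fun η' hη' => hη.unique hmd hσ hη'⟩, hval, hsymm, fun Y hY => ?_⟩
  rw [hval, hsymm.eq]
  exact hlow Y hY
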